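/- Let $n\ge 2$ and $m\ge 0$ be integers and let $B_m(\lambda)=\prod_{j=1}^m(\lambda-\beta_j)$ be a polynomial with real coefficients whose roots $\beta_1,\dots,\beta_m\in\mathbb C$ are pairwise distinct ($B_0=1$). On the open set $D\subset\mathbb R^n$ of all $\lambda=(\lambda_1,\dots,\lambda_n)$ with pairwise distinct $\lambda_i$ and $B_m(\lambda_i)\neq 0$ for all $i$, consider the pseudo-Riemannian metric with contravariant components $$G=\operatorname{diag}\left(\frac{B_m(\lambda_1)}{\Delta_1},\dots,\frac{B_m(\lambda_n)}{\Delta_n}\right),\qquad \Delta_i=\prod_{j\ne i}(\lambda_i-\lambda_j).$$ Let $U\subseteq D$ be any nonempty open set (for example $U=D$). Then: 1. $G$ is flat on $U$ (its Riemann curvature tensor vanishes on $U$) if and only if $m\le n$. 2. If $m=n+1$, then $G$ has constant nonzero curvature on $U$: there is $K\neq 0$ such that every nondegenerate tangent plane at every point of $U$ has sectional curvature $K$. 3. If $m>n+1$, then $G$ has non-constant curvature on $U$: there is no $K$ such that every nondegenerate tangent plane at every point of $U$ has sectional curvature $K$; moreover, the scalar curvature of $G$ is not a constant function on $U$. -/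

import Mathlib

open Polynomial

/-! Local pseudo-Riemannian geometry on open subsets of `ℝⁿ` with the coordinates `λ₁, …, λₙ`.
A metric (of any signature) is given by its contravariant components `G`, a matrix-valued function
of the point; its covariant components are the inverse matrix. -/

noncomputable section

namespace Benenti

variable {n : ℕ}

/-- The partial derivative `∂f/∂λᵢ` at `x`. -/
def partialDeriv (i : Fin n) (f : (Fin n → ℝ) → ℝ) (x : Fin n → ℝ) : ℝ :=
  fderiv ℝ f x (Pi.single i 1)

/-- The covariant components `g_{ij}` of the metric with contravariant components `G^{ij}`. -/
def covariant (G : (Fin n → ℝ) → Matrix (Fin n) (Fin n) ℝ) (x : Fin n → ℝ) :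
    Matrix (Fin n) (Fin n) ℝ :=
  (G x)⁻¹

/-- The Christoffel symbol `Γ^k_{ij}` of the Levi-Civita connection,
`Γ^k_{ij} = ½ ∑ₗ G^{kl} (∂ᵢ g_{jl} + ∂ⱼ g_{il} - ∂ₗ g_{ij})`. -/
def christoffel (G : (Fin n → ℝ) → Matrix (Fin n) (Fin n) ℝ) (k i j : Fin n)
    (x : Fin n → ℝ) : ℝ :=
  (1 / 2 : ℝ) * ∑ l, G x k l *
    (partialDeriv i (fun y => covariant G y j l) x
      + partialDeriv j (fun y => covariant G y i l) x
      - partialDeriv l (fun y => covariant G y i j) x)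

/-- The component `R^l_{kij}` of the Riemann curvature tensor, in the convention
`R(∂ᵢ, ∂ⱼ) ∂ₖ = ∇ᵢ ∇ⱼ ∂ₖ - ∇ⱼ ∇ᵢ ∂ₖ = ∑ₗ R^l_{kij} ∂ₗ`. -/
def riemann (G : (Fin n → ℝ) → Matrix (Fin n) (Fin n) ℝ) (l k i j : Fin n)
    (x : Fin n → ℝ) : ℝ :=
  partialDeriv i (christoffel G l j k) x - partialDeriv j (christoffel G l i k) x
    + ∑ p, (christoffel G l i p x * christoffel G p j k x
      - christoffel G l j p x * christoffel G p i k x)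

/-- The scalar product `g(u, v)` of two tangent vectors at `x`. -/
def inner (G : (Fin n → ℝ) → Matrix (Fin n) (Fin n) ℝ) (x u v : Fin n → ℝ) : ℝ :=
  ∑ i, ∑ j, covariant G x i j * u i * v j

/-- The vector `R(u, v) w` at `x`. -/
def curvatureOperator (G : (Fin n → ℝ) → Matrix (Fin n) (Fin n) ℝ)
    (x u v w : Fin n → ℝ) : Fin n → ℝ :=
  fun l => ∑ k, ∑ i, ∑ j, riemann G l k i j x * u i * v j * w k

/-- `g(u, u) g(v, v) - g(u, v)²`, which is nonzero exactly when `u, v` span a nondegenerate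
tangent plane. -/
def planeGram (G : (Fin n → ℝ) → Matrix (Fin n) (Fin n) ℝ) (x u v : Fin n → ℝ) : ℝ :=
  inner G x u u * inner G x v v - inner G x u v ^ 2

/-- The sectional curvature `g(R(u, v) v, u) / (g(u, u) g(v, v) - g(u, v)²)` of the plane spanned
by `u, v`, meaningful when that plane is nondegenerate. -/
def sectionalCurvature (G : (Fin n → ℝ) → Matrix (Fin n) (Fin n) ℝ) (x u v : Fin n → ℝ) : ℝ :=
  inner G x (curvatureOperator G x u v v) u / planeGram G x u v

/-- The component `R_{kj} = ∑ᵢ R^i_{kij}` of the Ricci tensor. -/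
def ricci (G : (Fin n → ℝ) → Matrix (Fin n) (Fin n) ℝ) (k j : Fin n) (x : Fin n → ℝ) : ℝ :=
  ∑ i, riemann G i k i j x

/-- The scalar curvature `∑ G^{kj} R_{kj}`. -/
def scalarCurvature (G : (Fin n → ℝ) → Matrix (Fin n) (Fin n) ℝ) (x : Fin n → ℝ) : ℝ :=
  ∑ k, ∑ j, G x k j * ricci G k j x

/-- The metric is flat on `U`: its Riemann curvature tensor vanishes there. -/
def IsFlatOn (G : (Fin n → ℝ) → Matrix (Fin n) (Fin n) ℝ) (U : Set (Fin n → ℝ)) : Prop :=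
  ∀ x ∈ U, ∀ l k i j, riemann G l k i j x = 0

/-- The metric has constant curvature `K` on `U`: at every point of `U`, all nondegenerate tangent
planes have sectional curvature `K`. -/
def HasConstantCurvatureOn (G : (Fin n → ℝ) → Matrix (Fin n) (Fin n) ℝ)
    (U : Set (Fin n → ℝ)) (K : ℝ) : Prop :=
  ∀ x ∈ U, ∀ u v, planeGram G x u v ≠ 0 → sectionalCurvature G x u v = K

/-- The contravariant Benenti metric `diag(B(λ₁)/Δ₁, …, B(λₙ)/Δₙ)`, `Δᵢ = ∏_{j ≠ i} (λᵢ - λⱼ)`. -/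
def benentiMetric (n : ℕ) (B : ℝ[X]) (x : Fin n → ℝ) : Matrix (Fin n) (Fin n) ℝ :=
  Matrix.diagonal fun i => B.eval (x i) / ∏ j ∈ Finset.univ.erase i, (x i - x j)

/-- The open set of all `λ` at which the Benenti metric is defined (the `λᵢ` are distinct) and
nondegenerate (no `λᵢ` is a root of `B`). -/
def benentiDomain (n : ℕ) (B : ℝ[X]) : Set (Fin n → ℝ) :=
  {x | Function.Injective x ∧ ∀ i, B.eval (x i) ≠ 0}

end Benenti

end

/-! Put `P = ∏ₖ (X - λₖ)` and let `Q` be the quotient of `B` by `P`. The metric is diagonal, and its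
logarithmic derivatives satisfy `∂ⱼ log gᵢ = 1 / (λⱼ - λᵢ)` for `i ≠ j`. Partial fractions then kill
every curvature component except those of the coordinate planes (`riemann_eq`), so one number per
pair `i ≠ j` encodes the curvature.

That number is linear in `B`: it is `-1/4` times the divided difference of `B` at `λ₁, …, λₙ, λᵢ,
λⱼ` (`coordCurvature_benenti`). Remainders modulo `P` do not contribute, hence it equals `-1/4`
times the slope of `Q` between `λᵢ` and `λⱼ` (`residueSum_eq`). If `deg B ≤ n`, then `Q` is constant
and the metric is flat; if `deg B = n + 1`, then `Q` is monic linear and the curvature is `-1/4`.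

For the converses, the scalar curvature is followed along the line `λ + t (1, …, 1)`. When `deg B ≥
n + 1` it is a polynomial in `t` whose coefficient at `t ^ (deg B - n - 1)` is nonzero
(`coeff_slopeSumPoly_ne_zero`). If it is constant near `t = 0`, then `deg B = n + 1` and the
constant is nonzero (`eq_and_ne_zero_of_scalarCurvature_eq`). -/

noncomputable section

namespace Benenti

variable {n : ℕ}

/-! ### Calculus of partial derivatives -/

theorem partialDeriv_congr {i : Fin n} {f h : (Fin n → ℝ) → ℝ} {x : Fin n → ℝ}
    (hfh : f =ᶠ[nhds x] h) : partialDeriv i f x = partialDeriv i h x := by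
  simp only [partialDeriv, hfh.fderiv_eq]

theorem partialDeriv_add (i : Fin n) {f h : (Fin n → ℝ) → ℝ} {x : Fin n → ℝ}
    (hf : DifferentiableAt ℝ f x) (hh : DifferentiableAt ℝ h x) :
    partialDeriv i (fun y => f y + h y) x = partialDeriv i f x + partialDeriv i h x := by
  simp only [partialDeriv, fderiv_fun_add hf hh, add_apply]

theorem partialDeriv_sub (i : Fin n) {f h : (Fin n → ℝ) → ℝ} {x : Fin n → ℝ}
    (hf : DifferentiableAt ℝ f x) (hh : DifferentiableAt ℝ h x) :
    partialDeriv i (fun y => f y - h y) x = partialDeriv i f x - partialDeriv i h x := by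
  simp only [partialDeriv, fderiv_fun_sub hf hh, sub_apply]

theorem partialDeriv_mul (i : Fin n) {f h : (Fin n → ℝ) → ℝ} {x : Fin n → ℝ}
    (hf : DifferentiableAt ℝ f x) (hh : DifferentiableAt ℝ h x) :
    partialDeriv i (fun y => f y * h y) x
      = partialDeriv i f x * h x + f x * partialDeriv i h x := by
  simp only [partialDeriv, fderiv_fun_mul hf hh, add_apply, smul_apply,
    smul_eq_mul]
  ring

theorem partialDeriv_const (i : Fin n) (c : ℝ) (x : Fin n → ℝ) :
    partialDeriv i (fun _ => c) x = 0 := by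
  simp [partialDeriv]

theorem partialDeriv_const_mul (i : Fin n) (c : ℝ) {f : (Fin n → ℝ) → ℝ} {x : Fin n → ℝ}
    (hf : DifferentiableAt ℝ f x) :
    partialDeriv i (fun y => c * f y) x = c * partialDeriv i f x := by
  simp [partialDeriv_mul i (differentiableAt_const c) hf, partialDeriv_const]

theorem partialDeriv_inv (i : Fin n) {f : (Fin n → ℝ) → ℝ} {x : Fin n → ℝ}
    (hf : DifferentiableAt ℝ f x) (h0 : f x ≠ 0) :
    partialDeriv i (fun y => (f y)⁻¹) x = -partialDeriv i f x / f x ^ 2 := by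
  have h := (hasDerivAt_inv h0).comp_hasFDerivAt x hf.hasFDerivAt
  have h' : fderiv ℝ (fun y => (f y)⁻¹) x = _ := h.fderiv
  simp only [partialDeriv, h', smul_apply, smul_eq_mul]
  ring

theorem partialDeriv_coord (i k : Fin n) (x : Fin n → ℝ) :
    partialDeriv i (fun y => y k) x = if i = k then 1 else 0 := by
  have h : fderiv ℝ (fun y : Fin n → ℝ => y k) x = ContinuousLinearMap.proj k :=
    (ContinuousLinearMap.proj (R := ℝ) (φ := fun _ : Fin n => ℝ) k).fderiv
  simp [partialDeriv, h, Pi.single_apply, eq_comm]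

theorem partialDeriv_comp_coord (i k : Fin n) {φ : ℝ → ℝ} {φ' : ℝ} {x : Fin n → ℝ}
    (h : HasDerivAt φ φ' (x k)) :
    partialDeriv i (fun y => φ (y k)) x = if i = k then φ' else 0 := by
  have hc : DifferentiableAt ℝ (fun y : Fin n → ℝ => y k) x := by fun_prop
  have h2 := h.comp_hasFDerivAt x hc.hasFDerivAt
  have h3 : fderiv ℝ (fun y => φ (y k)) x = _ := h2.fderiv
  have h4 := partialDeriv_coord i k x
  simp only [partialDeriv] at h4
  simp only [partialDeriv, h3, smul_apply, smul_eq_mul, h4]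
  split_ifs <;> simp

theorem partialDeriv_sum (i : Fin n) {ι : Type*} (s : Finset ι) {f : ι → (Fin n → ℝ) → ℝ}
    {x : Fin n → ℝ} (hf : ∀ k ∈ s, DifferentiableAt ℝ (f k) x) :
    partialDeriv i (fun y => ∑ k ∈ s, f k y) x = ∑ k ∈ s, partialDeriv i (f k) x := by
  simp only [partialDeriv, fderiv_fun_sum hf, sum_apply]

theorem partialDeriv_prod (i : Fin n) {ι : Type*} (s : Finset ι) {f : ι → (Fin n → ℝ) → ℝ}
    {x : Fin n → ℝ} (hf : ∀ k ∈ s, DifferentiableAt ℝ (f k) x) (h0 : ∀ k ∈ s, f k x ≠ 0) :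
    partialDeriv i (fun y => ∏ k ∈ s, f k y) x
      = (∏ k ∈ s, f k x) * ∑ k ∈ s, partialDeriv i (f k) x / f k x := by
  classical
  induction s using Finset.induction_on with
  | empty => simp [partialDeriv_const]
  | insert a s ha ih =>
    have hs : ∀ k ∈ s, DifferentiableAt ℝ (f k) x := fun k hk => hf k (Finset.mem_insert_of_mem hk)
    have hs0 : ∀ k ∈ s, f k x ≠ 0 := fun k hk => h0 k (Finset.mem_insert_of_mem hk)
    have ha0 := h0 a (Finset.mem_insert_self a s)
    simp only [Finset.prod_insert ha, Finset.sum_insert ha]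
    have hp : DifferentiableAt ℝ (fun y => ∏ k ∈ s, f k y) x := by
      classical
      exact (HasFDerivAt.finsetProd fun k hk => (hs k hk).hasFDerivAt).differentiableAt
    rw [partialDeriv_mul i (hf a (Finset.mem_insert_self a s)) hp, ih hs hs0]
    field_simp

/-! ### Christoffel symbols and curvature of a diagonal metric -/

/-- The diagonal metric with covariant components `gᵢ` on an open set `s`, together with the
logarithmic derivatives `A i j = ∂ⱼ log gᵢ`. -/
structure IsDiagonalMetricOn (G : (Fin n → ℝ) → Matrix (Fin n) (Fin n) ℝ)
    (g : Fin n → (Fin n → ℝ) → ℝ) (A : Fin n → Fin n → (Fin n → ℝ) → ℝ)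
    (s : Set (Fin n → ℝ)) : Prop where
  isOpen : IsOpen s
  eq_diagonal : ∀ y ∈ s, G y = Matrix.diagonal fun i => (g i y)⁻¹
  ne_zero : ∀ y ∈ s, ∀ i, g i y ≠ 0
  differentiableAt : ∀ y ∈ s, ∀ i, DifferentiableAt ℝ (g i) y
  partialDeriv_eq : ∀ y ∈ s, ∀ i j, partialDeriv j (g i) y = g i y * A i j y
  differentiableAt_log : ∀ y ∈ s, ∀ i j, DifferentiableAt ℝ (A i j) y

namespace IsDiagonalMetricOn

variable {G : (Fin n → ℝ) → Matrix (Fin n) (Fin n) ℝ} {g : Fin n → (Fin n → ℝ) → ℝ}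
  {A : Fin n → Fin n → (Fin n → ℝ) → ℝ} {s : Set (Fin n → ℝ)} {x : Fin n → ℝ}

theorem covariant_eq (h : IsDiagonalMetricOn G g A s) (hx : x ∈ s) :
    covariant G x = Matrix.diagonal fun i => g i x := by
  rw [covariant, h.eq_diagonal x hx]
  refine Matrix.inv_eq_left_inv ?_
  rw [Matrix.diagonal_mul_diagonal, ← Matrix.diagonal_one]
  congr 1
  funext i
  exact mul_inv_cancel₀ (h.ne_zero x hx i)

theorem inner_eq (h : IsDiagonalMetricOn G g A s) (hx : x ∈ s) (u v : Fin n → ℝ) :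
    inner G x u v = ∑ i, g i x * u i * v i := by
  simp [inner, h.covariant_eq hx, Matrix.diagonal_apply]

theorem partialDeriv_covariant (h : IsDiagonalMetricOn G g A s) (hx : x ∈ s) (l i j : Fin n) :
    partialDeriv l (fun y => covariant G y i j) x = if i = j then g i x * A i l x else 0 := by
  have he : (fun y => covariant G y i j) =ᶠ[nhds x] fun y => if i = j then g i y else 0 := by
    filter_upwards [h.isOpen.mem_nhds hx] with y hy
    rw [h.covariant_eq hy, Matrix.diagonal_apply]
  rw [partialDeriv_congr he]
  split_ifs
  · exact h.partialDeriv_eq x hx i l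
  · exact partialDeriv_const _ _ _

theorem christoffel_eq (h : IsDiagonalMetricOn G g A s) (hx : x ∈ s) (k i j : Fin n) :
    christoffel G k i j x = (1 / 2) * ((if j = k then A k i x else 0)
      + (if i = k then A k j x else 0) - (if i = j then g i x * (g k x)⁻¹ * A i k x else 0)) := by
  simp only [christoffel, h.partialDeriv_covariant hx]
  rw [h.eq_diagonal x hx]
  simp only [Matrix.diagonal_apply, ite_mul, zero_mul, Finset.sum_ite_eq, Finset.mem_univ, if_true]
  have hk := h.ne_zero x hx k
  congr 1
  split_ifs <;> subst_vars <;> field_simp <;> ring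

theorem partialDeriv_christoffel (h : IsDiagonalMetricOn G g A s) (hx : x ∈ s) (l k i j : Fin n) :
    partialDeriv l (christoffel G k i j) x
      = (1 / 2) * ((if j = k then partialDeriv l (A k i) x else 0)
      + (if i = k then partialDeriv l (A k j) x else 0)
      - (if i = j then g i x * (g k x)⁻¹ * ((A i l x - A k l x) * A i k x
          + partialDeriv l (A i k) x) else 0)) := by
  have he : christoffel G k i j =ᶠ[nhds x] fun y => (1 / 2) * ((if j = k then A k i y else 0)
      + (if i = k then A k j y else 0)
      - (if i = j then g i y * (g k y)⁻¹ * A i k y else 0)) := by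
    filter_upwards [h.isOpen.mem_nhds hx] with y hy using h.christoffel_eq hy k i j
  have hk := h.ne_zero x hx k
  have dA := h.differentiableAt_log x hx
  have dg := h.differentiableAt x hx
  have di : DifferentiableAt ℝ (fun y => (g k y)⁻¹) x := (dg k).inv hk
  have d1 : DifferentiableAt ℝ (fun y => if j = k then A k i y else 0) x := by
    split_ifs
    · exact dA _ _
    · exact differentiableAt_const _
  have d2 : DifferentiableAt ℝ (fun y => if i = k then A k j y else 0) x := by
    split_ifs
    · exact dA _ _
    · exact differentiableAt_const _
  have dgg : DifferentiableAt ℝ (fun y => g i y * (g k y)⁻¹) x := (dg i).mul di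
  have d3 : DifferentiableAt ℝ (fun y => if i = j then g i y * (g k y)⁻¹ * A i k y else 0) x := by
    split_ifs
    · exact dgg.mul (dA _ _)
    · exact differentiableAt_const _
  rw [partialDeriv_congr he, partialDeriv_const_mul l _ ((d1.fun_add d2).fun_sub d3),
    partialDeriv_sub l (d1.fun_add d2) d3, partialDeriv_add l d1 d2]
  congr 2
  · congr 1 <;> split_ifs <;> first | rfl | exact partialDeriv_const _ _ _
  · split_ifs
    · rw [partialDeriv_mul l dgg (dA i k), partialDeriv_mul l (dg i) di,
        partialDeriv_inv l (dg k) hk, h.partialDeriv_eq x hx, h.partialDeriv_eq x hx]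
      field_simp
      ring
    · exact partialDeriv_const _ _ _

theorem sum_christoffel_mul (h : IsDiagonalMetricOn G g A s) (hx : x ∈ s) (l k i j : Fin n) :
    ∑ p, christoffel G l i p x * christoffel G p j k x
      = (1 / 4) * (A l i x * ((if l = k then A l j x else 0) + (if l = j then A l k x else 0)
          - (if j = k then g j x * (g l x)⁻¹ * A j l x else 0))
        + (if l = i then A l k x * A k j x + A l j x * A j k x
          - (if j = k then ∑ p, A l p x * (g j x * (g p x)⁻¹ * A j p x) else 0) else 0)
        - g i x * (g l x)⁻¹ * A i l x * ((if i = k then A i j x else 0)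
          + (if i = j then A i k x else 0)
          - (if j = k then g j x * (g i x)⁻¹ * A j i x else 0))) := by
  simp only [h.christoffel_eq hx]
  -- Each indicator involving `p` is moved outermost, so that the sum over `p` collapses. Only the
  -- part with `l = i` and `j = k` keeps a genuine sum.
  have e : ∀ p, (1 / 2 : ℝ) * ((if p = l then A l i x else 0) + (if i = l then A l p x else 0)
        - (if i = p then g i x * (g l x)⁻¹ * A i l x else 0)) *
      ((1 / 2) * ((if k = p then A p j x else 0) + (if j = p then A p k x else 0)
        - (if j = k then g j x * (g p x)⁻¹ * A j p x else 0)))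
      = (1 / 4) * ((if l = p then A l i x * ((if p = k then A p j x else 0)
            + (if p = j then A p k x else 0)
            - (if j = k then g j x * (g p x)⁻¹ * A j p x else 0)) else 0)
        + ((if k = p then (if l = i then A l p x * A p j x else 0) else 0)
          + (if j = p then (if l = i then A l p x * A p k x else 0) else 0)
          - (if l = i then (if j = k then A l p x * (g j x * (g p x)⁻¹ * A j p x) else 0) else 0))
        - (if i = p then g i x * (g l x)⁻¹ * A i l x * ((if p = k then A p j x else 0)
            + (if p = j then A p k x else 0)
            - (if j = k then g j x * (g p x)⁻¹ * A j p x else 0)) else 0)) := by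
    intro p
    simp only [eq_comm (a := p), eq_comm (a := i) (b := l)]
    split_ifs <;> ring
  simp only [e, ← Finset.mul_sum, Finset.sum_add_distrib, Finset.sum_sub_distrib,
    Finset.sum_ite_eq, Finset.mem_univ, if_true]
  congr 3
  split_ifs <;> simp

end IsDiagonalMetricOn

theorem riemann_antisymm (G : (Fin n → ℝ) → Matrix (Fin n) (Fin n) ℝ) (l k i j : Fin n)
    (x : Fin n → ℝ) : riemann G l k i j x = -riemann G l k j i x := by
  simp only [riemann, Finset.sum_sub_distrib]
  ring

namespace IsDiagonalMetricOn

variable {G : (Fin n → ℝ) → Matrix (Fin n) (Fin n) ℝ} {g : Fin n → (Fin n → ℝ) → ℝ}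
  {A : Fin n → Fin n → (Fin n → ℝ) → ℝ} {s : Set (Fin n → ℝ)} {x : Fin n → ℝ}

/-- The sectional curvature of the coordinate plane `∂ᵢ, ∂ⱼ` of a diagonal metric whose
off-diagonal logarithmic derivatives are `∂ⱼ log gᵢ = 1 / (λⱼ - λᵢ)`. -/
def coordCurvature (g : Fin n → (Fin n → ℝ) → ℝ) (A : Fin n → Fin n → (Fin n → ℝ) → ℝ)
    (x : Fin n → ℝ) (i j : Fin n) : ℝ :=
  (1 / 4) * ((1 / (x j - x i) ^ 2 - 2 * A i i x / (x j - x i)) * (g i x)⁻¹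
    + (1 / (x j - x i) ^ 2 + 2 * A j j x / (x j - x i)) * (g j x)⁻¹
    - ∑ p, A i p x * A j p x * (g p x)⁻¹)

/-- The diagonal entries `A i i` stay arbitrary: only their derivatives in the other directions
matter, and `hd` is what the symmetry of second derivatives of `log gᵢ` dictates. -/
theorem riemann_eq (h : IsDiagonalMetricOn G g A s) (hx : x ∈ s) (hinj : Function.Injective x)
    (hA : ∀ i j, i ≠ j → A i j x = 1 / (x j - x i))
    (hA' : ∀ l i j, i ≠ j → partialDeriv l (A i j) x
      = ((if l = i then 1 else 0) - (if l = j then 1 else 0)) / (x j - x i) ^ 2)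
    (hd : ∀ i l, l ≠ i → partialDeriv l (A i i) x = 1 / (x i - x l) ^ 2)
    (l k i j : Fin n) (hij : i ≠ j) :
    riemann G l k i j x = coordCurvature g A x i j
      * ((if l = i ∧ k = j then g j x else 0) - (if l = j ∧ k = i then g i x else 0)) := by
  have hne : ∀ a b, a ≠ b → x a - x b ≠ 0 := fun a b hab => sub_ne_zero.2 (hinj.ne hab)
  have hg := h.ne_zero x hx
  -- Since `i ≠ j`, the index `l` differs from one of them; antisymmetry in `i, j` lets that one be
  -- `j`.
  have key : ∀ l k i j : Fin n, i ≠ j → l ≠ j → riemann G l k i j x = coordCurvature g A x i j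
      * (if l = i ∧ k = j then g j x else 0) := by
    intro l k i j hij hlj
    have e1 := h.partialDeriv_christoffel hx i l j k
    have e2 := h.partialDeriv_christoffel hx j l i k
    have e3 := h.sum_christoffel_mul hx l k i j
    have e4 := h.sum_christoffel_mul hx l k j i
    simp only [riemann, Finset.sum_sub_distrib]
    rw [e1, e2, e3, e4]
    clear e1 e2 e3 e4
    have nij := hne i j hij
    have nji := hne j i hij.symm
    have nlj := hne l j hlj
    have njl := hne j l hlj.symm
    by_cases hli : l = i
    · subst hli
      by_cases hkj : k = j
      · subst hkj
        have es : ∑ p, A l p x * (g k x * (g p x)⁻¹ * A k p x)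
            = g k x * ∑ p, A l p x * A k p x * (g p x)⁻¹ := by
          rw [Finset.mul_sum]
          exact Finset.sum_congr rfl fun p _ => by ring
        simp only [hij, hij.symm, if_true, if_false, es, hA' _ _ _ hij, hA' _ _ _ hij.symm,
          hA _ _ hij, hA _ _ hij.symm, coordCurvature, and_self]
        have := hg k
        have := hg l
        generalize ∑ p, A l p x * A k p x * (g p x)⁻¹ = S
        rw [← neg_sub (x k) (x l)]
        field_simp
        ring
      · by_cases hkl : k = l
        · subst hkl
          simp only [hij, hij.symm, if_true, if_false, hA' _ _ _ hij, hA' _ _ _ hij.symm,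
            hA _ _ hij, hA _ _ hij.symm, hd _ _ hij.symm, and_false]
          have := hg k
          have := hg j
          rw [← neg_sub (x j) (x k)]
          field_simp
          ring
        -- With `l = i` and `i, j, k` distinct, what remains is the partial fraction identity `A i k
        -- * A k j + A i j * A j k = A i j * A i k`.
        · have hjk := Ne.symm hkj
          have hlk := Ne.symm hkl
          have := hne _ _ hkl
          have := hne _ _ hlk
          have := hne _ _ hkj
          have := hne _ _ hjk
          simp only [hij, hij.symm, hkj, hjk, hkl, hlk, if_true, if_false, hA' _ _ _ hlk,
            hA _ _ hij, hA _ _ hkj, hA _ _ hjk, hA _ _ hlk, and_false]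
          rw [← neg_sub (x k) (x j)]
          field_simp
          ring
    · have hil := Ne.symm hli
      have hjl := Ne.symm hlj
      have nli := hne l i hli
      have nil := hne i l hil
      by_cases hkj : k = j
      · subst hkj
        simp only [hij, hij.symm, hli, hil, hlj, hjl, if_true, if_false, hA' _ _ _ hjl,
            hA _ _ hij.symm, hA _ _ hjl, hA _ _ hli, hA _ _ hil, false_and]
        have := hg k
        have := hg l
        have := hg i
        rw [← neg_sub (x l) (x i), ← neg_sub (x k) (x i)]
        field_simp
        ring
      · by_cases hki : k = i
        · subst hki
          simp only [hij, hij.symm, hli, hil, hlj, hjl, if_true, if_false, hA' _ _ _ hil,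
            hA _ _ hij, hA _ _ hjl, hA _ _ hlj, hA _ _ hil, false_and]
          have := hg k
          have := hg l
          have := hg j
          rw [← neg_sub (x l) (x j), ← neg_sub (x k) (x j)]
          field_simp
          ring
        · have hik := Ne.symm hki
          have hjk := Ne.symm hkj
          by_cases hkl : k = l
          · subst hkl
            simp only [hij, hij.symm, hli, hil, hlj, hjl, if_true, if_false, hA' _ _ _ hlj,
              hA' _ _ _ hli, false_and]
            ring
          · have hlk := Ne.symm hkl
            simp only [hij, hij.symm, hli, hil, hlj, hjl, hik, hjk, hkj, hkl, hlk, if_false,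
              false_and]
            ring
  have symm : coordCurvature g A x i j = coordCurvature g A x j i := by
    have es : ∑ p, A i p x * A j p x * (g p x)⁻¹ = ∑ p, A j p x * A i p x * (g p x)⁻¹ :=
      Finset.sum_congr rfl fun p _ => by ring
    simp only [coordCurvature, es]
    rw [← neg_sub (x j) (x i), div_neg, neg_sq, div_neg]
    ring
  by_cases hlj : l = j
  · rw [riemann_antisymm, key l k j i hij.symm (fun e => hij (e.symm.trans hlj)), symm]
    have : ¬(l = i ∧ k = j) := fun e => hij (e.1.symm.trans hlj)
    simp only [this, if_false]
    ring
  · rw [key l k i j hij hlj]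
    have : ¬(l = j ∧ k = i) := fun e => hlj e.1
    simp only [this, if_false, sub_zero]

end IsDiagonalMetricOn

/-! ### Divided differences at the nodes -/

/-- The product `Δᵢ = ∏_{j ≠ i} (λᵢ - λⱼ)`. -/
def nodeProd (x : Fin n → ℝ) (i : Fin n) : ℝ := ∏ j ∈ Finset.univ.erase i, (x i - x j)

theorem nodeProd_ne_zero {x : Fin n → ℝ} (hx : Function.Injective x) (i : Fin n) :
    nodeProd x i ≠ 0 :=
  Finset.prod_ne_zero_iff.2 fun _ hj =>
    sub_ne_zero.2 (hx.ne (Finset.ne_of_mem_erase hj).symm)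

/-- Minus the sum of the residues of `B(z) / (∏ₖ (z - λₖ) (z - λᵢ) (z - λⱼ))`, that is, minus the
divided difference of `B` at the nodes `λ₁, …, λₙ, λᵢ, λⱼ`, written out for `i ≠ j`. -/
def residueSum (x : Fin n → ℝ) (i j : Fin n) : ℝ[X] →ₗ[ℝ] ℝ where
  toFun B := (nodeProd x i)⁻¹ * (B.eval (x i) / (x j - x i) ^ 2
      - (B.eval (x i) * ∑ k ∈ Finset.univ.erase i, 1 / (x i - x k) - B.derivative.eval (x i))
        / (x j - x i))
    + (nodeProd x j)⁻¹ * (B.eval (x j) / (x j - x i) ^ 2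
      + (B.eval (x j) * ∑ k ∈ Finset.univ.erase j, 1 / (x j - x k) - B.derivative.eval (x j))
        / (x j - x i))
    - ∑ p ∈ (Finset.univ.erase i).erase j,
        B.eval (x p) / (nodeProd x p * ((x p - x i) * (x p - x j)))
  map_add' B C := by
    simp only [eval_add, derivative_add, add_div, Finset.sum_add_distrib]
    ring
  map_smul' c B := by
    simp only [eval_smul, derivative_smul, smul_eq_mul, mul_div_assoc, ← Finset.mul_sum,
      RingHom.id_apply]
    ring

theorem eval_nodal_erase (x : Fin n → ℝ) (p q : Fin n) :
    (Lagrange.nodal (Finset.univ.erase q) x).eval (x p) = if p = q then nodeProd x q else 0 := by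
  split_ifs with h
  · subst h
    rw [Lagrange.eval_nodal, nodeProd]
  · exact Lagrange.eval_nodal_at_node (Finset.mem_erase.2 ⟨h, Finset.mem_univ p⟩)

theorem eval_derivative_nodal_erase_of_ne {x : Fin n → ℝ} (hx : Function.Injective x)
    {i q : Fin n} (hiq : i ≠ q) :
    (Lagrange.nodal (Finset.univ.erase q) x).derivative.eval (x i)
      = nodeProd x i / (x i - x q) := by
  rw [Lagrange.eval_nodal_derivative_eval_node_eq (Finset.mem_erase.2 ⟨hiq, Finset.mem_univ i⟩),
    Lagrange.eval_nodal, nodeProd, Finset.erase_right_comm,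
    ← Finset.mul_prod_erase (Finset.univ.erase i) (fun j => x i - x j)
      (Finset.mem_erase.2 ⟨hiq.symm, Finset.mem_univ q⟩)]
  have := sub_ne_zero.2 (hx.ne hiq)
  field_simp

theorem eval_derivative_nodal_erase_self {x : Fin n → ℝ} (hx : Function.Injective x)
    (q : Fin n) :
    (Lagrange.nodal (Finset.univ.erase q) x).derivative.eval (x q)
      = nodeProd x q * ∑ k ∈ Finset.univ.erase q, 1 / (x q - x k) := by
  rw [Lagrange.derivative_nodal, eval_finsetSum, Finset.mul_sum]
  refine Finset.sum_congr rfl fun k hk => ?_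
  rw [Lagrange.eval_nodal, nodeProd,
    ← Finset.mul_prod_erase (Finset.univ.erase q) (fun j => x q - x j) hk]
  have := sub_ne_zero.2 (hx.ne (Finset.ne_of_mem_erase hk).symm)
  field_simp

/-- This polynomial vanishes at every node but `λ_q`, so only its value there and its derivatives at
`λᵢ, λⱼ` enter, leaving a rational identity in at most three nodes. -/
theorem residueSum_nodal_erase {x : Fin n → ℝ} (hx : Function.Injective x) {i j : Fin n}
    (hij : i ≠ j) (q : Fin n) :
    residueSum x i j (Lagrange.nodal (Finset.univ.erase q) x) = 0 := by
  have hne : ∀ a b, a ≠ b → x a - x b ≠ 0 := fun a b hab => sub_ne_zero.2 (hx.ne hab)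
  have hΔ := nodeProd_ne_zero hx
  have := hΔ i
  have := hΔ j
  have := hΔ q
  have nji := hne j i hij.symm
  simp only [residueSum, LinearMap.coe_mk, AddHom.coe_mk, eval_nodal_erase]
  by_cases hqi : q = i
  · subst hqi
    have hs : ∑ p ∈ (Finset.univ.erase q).erase j, (if p = q then nodeProd x q else 0)
        / (nodeProd x p * ((x p - x q) * (x p - x j))) = 0 :=
      Finset.sum_eq_zero fun p hp => by
        rw [if_neg (Finset.ne_of_mem_erase (Finset.mem_of_mem_erase hp)), zero_div]
    rw [hs, eval_derivative_nodal_erase_self hx, eval_derivative_nodal_erase_of_ne hx hij.symm]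
    simp only [hij.symm, if_true, if_false]
    generalize ∑ k ∈ Finset.univ.erase q, 1 / (x q - x k) = S
    field_simp
    ring
  · by_cases hqj : q = j
    · subst hqj
      have hs : ∑ p ∈ (Finset.univ.erase i).erase q, (if p = q then nodeProd x q else 0)
          / (nodeProd x p * ((x p - x i) * (x p - x q))) = 0 :=
        Finset.sum_eq_zero fun p hp => by
          rw [if_neg (Finset.ne_of_mem_erase hp), zero_div]
      rw [hs, eval_derivative_nodal_erase_self hx, eval_derivative_nodal_erase_of_ne hx hij]
      simp only [hij, if_true, if_false]
      generalize ∑ k ∈ Finset.univ.erase q, 1 / (x q - x k) = S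
      rw [← neg_sub (x q) (x i)]
      field_simp
      ring
    · have hiq := Ne.symm hqi
      have hjq := Ne.symm hqj
      have hs : ∑ p ∈ (Finset.univ.erase i).erase j, (if p = q then nodeProd x q else 0)
          / (nodeProd x p * ((x p - x i) * (x p - x j))) = 1 / ((x q - x i) * (x q - x j)) := by
        rw [Finset.sum_eq_single q]
        · rw [if_pos rfl]
          field_simp
        · intro p _ hpq
          rw [if_neg hpq, zero_div]
        · intro hq
          exact absurd (Finset.mem_erase.2 ⟨hqj, Finset.mem_erase.2 ⟨hqi, Finset.mem_univ q⟩⟩) hq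
      rw [hs, eval_derivative_nodal_erase_of_ne hx hiq, eval_derivative_nodal_erase_of_ne hx hjq]
      simp only [hiq, hjq, if_false]
      have := hne _ _ hqi
      have := hne _ _ hqj
      rw [← neg_sub (x q) (x i), ← neg_sub (x q) (x j)]
      field_simp
      ring

/-- By Lagrange interpolation, such a polynomial is a linear combination of the nodal polynomials
with one node removed. -/
theorem residueSum_of_degree_lt {x : Fin n → ℝ} (hx : Function.Injective x) {i j : Fin n}
    (hij : i ≠ j) {r : ℝ[X]} (hr : r.degree < n) : residueSum x i j r = 0 := by
  rw [Lagrange.eq_interpolate (s := Finset.univ) (f := r) hx.injOn (by simpa using hr),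
    Lagrange.interpolate_apply, map_sum]
  refine Finset.sum_eq_zero fun q _ => ?_
  rw [Lagrange.basis_eq_prod_sub_inv_mul_nodal_div (Finset.mem_univ q),
    ← Lagrange.nodal_erase_eq_nodal_div (Finset.mem_univ q), ← smul_eq_C_mul, ← smul_eq_C_mul,
    map_smul, map_smul, residueSum_nodal_erase hx hij, smul_zero, smul_zero]

/-- The remainder modulo `P` has degree below `n` and drops out. The product `P * Q` vanishes at the
nodes and has derivative `Δₚ Q(λₚ)` there, so only the two derivative terms survive. -/
theorem residueSum_eq {x : Fin n → ℝ} (hx : Function.Injective x) {i j : Fin n}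
    (hij : i ≠ j) (B : ℝ[X]) :
    residueSum x i j B = -(((B /ₘ Lagrange.nodal Finset.univ x).eval (x i)
      - (B /ₘ Lagrange.nodal Finset.univ x).eval (x j)) / (x i - x j)) := by
  have hP : (Lagrange.nodal Finset.univ x).Monic := Lagrange.nodal_monic
  have hr : (B %ₘ Lagrange.nodal Finset.univ x).degree < n := by
    refine (degree_modByMonic_lt B hP).trans_le ?_
    rw [Lagrange.degree_nodal, Finset.card_univ, Fintype.card_fin]
  conv_lhs => rw [← modByMonic_add_div B (Lagrange.nodal Finset.univ x)]
  rw [map_add, residueSum_of_degree_lt hx hij hr, zero_add]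
  generalize B /ₘ Lagrange.nodal Finset.univ x = Q
  have h0 : ∀ p, (Lagrange.nodal Finset.univ x).eval (x p) = 0 :=
    fun p => Lagrange.eval_nodal_at_node (Finset.mem_univ p)
  have h1 : ∀ p, (Lagrange.nodal Finset.univ x).derivative.eval (x p) = nodeProd x p := fun p => by
    rw [Lagrange.eval_nodal_derivative_eval_node_eq (Finset.mem_univ p), Lagrange.eval_nodal,
      nodeProd]
  simp only [residueSum, LinearMap.coe_mk, AddHom.coe_mk, eval_mul, derivative_mul, eval_add, h0,
    h1, zero_mul, zero_div, Finset.sum_const_zero]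
  have := nodeProd_ne_zero hx i
  have := nodeProd_ne_zero hx j
  have := sub_ne_zero.2 (hx.ne hij.symm)
  rw [← neg_sub (x j) (x i)]
  field_simp
  ring

/-! ### The Benenti metric as a diagonal metric -/

theorem isOpen_benentiDomain (n : ℕ) (B : ℝ[X]) : IsOpen (benentiDomain n B) := by
  have h : benentiDomain n B = (⋂ i : Fin n, ⋂ j : Fin n, {x | i ≠ j → x i ≠ x j})
      ∩ ⋂ i : Fin n, {x | B.eval (x i) ≠ 0} := by
    ext x
    simp only [benentiDomain, Set.mem_ofPred_eq, Set.mem_inter_iff, Set.mem_iInter]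
    refine and_congr_left fun _ => ⟨fun h i j hij => h.ne hij, fun h i j => ?_⟩
    exact not_imp_not.1 (h i j)
  rw [h]
  refine (isOpen_iInter_of_finite fun i => isOpen_iInter_of_finite fun j => ?_).inter
    (isOpen_iInter_of_finite fun i => ?_)
  · by_cases hij : i = j
    · simp [hij]
    · simpa [hij] using isOpen_ne_fun (continuous_apply i) (continuous_apply j)
  · exact isOpen_ne_fun (B.continuous.comp (continuous_apply i)) continuous_const

/-- The covariant diagonal components `Δᵢ / B(λᵢ)` of the Benenti metric. -/
def benentiCov (B : ℝ[X]) (i : Fin n) (y : Fin n → ℝ) : ℝ := nodeProd y i * (B.eval (y i))⁻¹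

/-- The logarithmic derivatives of the covariant diagonal components of the Benenti metric. -/
def benentiLog (B : ℝ[X]) (i j : Fin n) (y : Fin n → ℝ) : ℝ :=
  if i = j then (∑ k ∈ Finset.univ.erase i, (y i - y k)⁻¹)
    - B.derivative.eval (y i) * (B.eval (y i))⁻¹
  else (y j - y i)⁻¹

theorem benentiLog_self (B : ℝ[X]) (i : Fin n) : benentiLog B i i = fun y =>
    (∑ k ∈ Finset.univ.erase i, (y i - y k)⁻¹) - B.derivative.eval (y i) * (B.eval (y i))⁻¹ := by
  funext y
  rw [benentiLog, if_pos rfl]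

theorem benentiLog_of_ne (B : ℝ[X]) {i j : Fin n} (hij : i ≠ j) :
    benentiLog B i j = fun y => (y j - y i)⁻¹ := by
  funext y
  rw [benentiLog, if_neg hij]

theorem differentiableAt_coord_sub (i k : Fin n) (x : Fin n → ℝ) :
    DifferentiableAt ℝ (fun y => y i - y k) x := by
  fun_prop

theorem differentiableAt_eval_coord (B : ℝ[X]) (i : Fin n) (x : Fin n → ℝ) :
    DifferentiableAt ℝ (fun y => B.eval (y i)) x :=
  B.differentiable.differentiableAt.comp x (differentiableAt_apply i x)

theorem partialDeriv_coord_sub (l i k : Fin n) (x : Fin n → ℝ) :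
    partialDeriv l (fun y => y i - y k) x = (if l = i then 1 else 0) - if l = k then 1 else 0 := by
  rw [partialDeriv_sub l (differentiableAt_apply i x) (differentiableAt_apply k x),
    partialDeriv_coord, partialDeriv_coord]

theorem partialDeriv_inv_coord_sub {x : Fin n → ℝ} (hx : Function.Injective x) (l : Fin n)
    {i k : Fin n} (hik : i ≠ k) :
    partialDeriv l (fun y => (y i - y k)⁻¹) x
      = ((if l = k then 1 else 0) - if l = i then 1 else 0) / (x i - x k) ^ 2 := by
  rw [partialDeriv_inv l (differentiableAt_coord_sub i k x) (sub_ne_zero.2 (hx.ne hik)),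
    partialDeriv_coord_sub, neg_sub]

theorem differentiableAt_inv_coord_sub {x : Fin n → ℝ} (hx : Function.Injective x)
    {i k : Fin n} (hik : i ≠ k) : DifferentiableAt ℝ (fun y => (y i - y k)⁻¹) x :=
  (differentiableAt_coord_sub i k x).fun_inv (sub_ne_zero.2 (hx.ne hik))

theorem differentiableAt_nodeProd (i : Fin n) (x : Fin n → ℝ) :
    DifferentiableAt ℝ (fun y => nodeProd y i) x :=
  (HasFDerivAt.finsetProd fun k _ =>
    (differentiableAt_coord_sub i k x).hasFDerivAt).differentiableAt

theorem partialDeriv_nodeProd {x : Fin n → ℝ} (hx : Function.Injective x) (i j : Fin n) :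
    partialDeriv j (fun y => nodeProd y i) x = nodeProd x i *
      if i = j then ∑ k ∈ Finset.univ.erase i, (x i - x k)⁻¹ else (x j - x i)⁻¹ := by
  have h := partialDeriv_prod j (Finset.univ.erase i) (f := fun k y => y i - y k) (x := x)
    (fun k _ => differentiableAt_coord_sub i k x)
    (fun k hk => sub_ne_zero.2 (hx.ne (Finset.ne_of_mem_erase hk).symm))
  simp only [nodeProd]
  rw [h]
  congr 1
  simp only [partialDeriv_coord_sub]
  by_cases hij : i = j
  · subst hij
    simp only [if_true]
    refine Finset.sum_congr rfl fun k hk => ?_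
    rw [if_neg (Finset.ne_of_mem_erase hk).symm, sub_zero, one_div]
  · rw [if_neg hij, Finset.sum_eq_single j]
    · rw [if_neg (Ne.symm hij), if_pos rfl, zero_sub, neg_div, ← div_neg, neg_sub, one_div]
    · intro k _ hkj
      rw [if_neg (Ne.symm hij), if_neg (Ne.symm hkj), sub_zero, zero_div]
    · intro hj
      exact absurd (Finset.mem_erase.2 ⟨Ne.symm hij, Finset.mem_univ j⟩) hj

theorem isDiagonalMetricOn_benenti (n : ℕ) (B : ℝ[X]) :
    IsDiagonalMetricOn (benentiMetric n B) (benentiCov B) (benentiLog B) (benentiDomain n B) where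
  isOpen := isOpen_benentiDomain n B
  eq_diagonal y _ := by
    simp only [benentiMetric, benentiCov, nodeProd, mul_inv, inv_inv, div_eq_mul_inv, mul_comm]
  ne_zero y hy i := mul_ne_zero (nodeProd_ne_zero hy.1 i) (inv_ne_zero (hy.2 i))
  differentiableAt y hy i :=
    (differentiableAt_nodeProd i y).fun_mul ((differentiableAt_eval_coord B i y).fun_inv (hy.2 i))
  partialDeriv_eq y hy i j := by
    have hB := hy.2 i
    have h := partialDeriv_mul j (differentiableAt_nodeProd i y)
      ((differentiableAt_eval_coord B i y).fun_inv hB)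
    have hc : benentiCov B i = fun y => nodeProd y i * (B.eval (y i))⁻¹ := rfl
    simp only [benentiLog]
    rw [hc, h, partialDeriv_nodeProd hy.1, partialDeriv_inv j (differentiableAt_eval_coord B i y) hB,
      partialDeriv_comp_coord j i (B.hasDerivAt (y i))]
    by_cases hij : i = j
    · simp only [hij, if_true]
      rw [hij] at hB
      field_simp
      ring
    · simp only [hij, Ne.symm hij, if_false]
      ring
  differentiableAt_log y hy i j := by
    by_cases hij : i = j
    · subst hij
      rw [benentiLog_self]
      exact (DifferentiableAt.fun_sum fun k hk =>
        differentiableAt_inv_coord_sub hy.1 (Finset.ne_of_mem_erase hk).symm).fun_sub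
        ((differentiableAt_eval_coord _ i y).fun_mul
          ((differentiableAt_eval_coord B i y).fun_inv (hy.2 i)))
    · rw [benentiLog_of_ne B hij]
      exact differentiableAt_inv_coord_sub hy.1 (Ne.symm hij)

/-- The terms `p = i` and `p = j` of the sum cancel half of the explicit terms in `A i i` and `A j
j`, which produces the coefficients of `residueSum`. -/
theorem coordCurvature_benenti {B : ℝ[X]} {x : Fin n → ℝ} (hx : x ∈ benentiDomain n B)
    {i j : Fin n} (hij : i ≠ j) :
    IsDiagonalMetricOn.coordCurvature (benentiCov B) (benentiLog B) x i j
      = (1 / 4) * residueSum x i j B := by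
  have hne : ∀ a b, a ≠ b → x a - x b ≠ 0 := fun a b hab => sub_ne_zero.2 (hx.1.ne hab)
  have hs : ∑ p, benentiLog B i p x * benentiLog B j p x * (benentiCov B p x)⁻¹
      = benentiLog B i i x * (x i - x j)⁻¹ * (benentiCov B i x)⁻¹
        + ((x j - x i)⁻¹ * benentiLog B j j x * (benentiCov B j x)⁻¹
        + ∑ p ∈ (Finset.univ.erase i).erase j,
          B.eval (x p) / (nodeProd x p * ((x p - x i) * (x p - x j)))) := by
    rw [← Finset.add_sum_erase _ _ (Finset.mem_univ i), ← Finset.add_sum_erase _ _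
      (Finset.mem_erase.2 ⟨hij.symm, Finset.mem_univ j⟩)]
    congr 1
    · rw [benentiLog_of_ne B hij.symm]
    congr 1
    · rw [benentiLog_of_ne B hij]
    refine Finset.sum_congr rfl fun p hp => ?_
    have hpj := Finset.ne_of_mem_erase hp
    have hpi := Finset.ne_of_mem_erase (Finset.mem_of_mem_erase hp)
    rw [benentiLog_of_ne B hpi.symm, benentiLog_of_ne B hpj.symm, benentiCov, mul_inv, inv_inv,
      div_eq_mul_inv, mul_inv, mul_inv]
    ring
  rw [IsDiagonalMetricOn.coordCurvature, hs]
  simp only [residueSum, LinearMap.coe_mk, AddHom.coe_mk, benentiLog_self, benentiCov, one_div]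
  generalize ∑ p ∈ (Finset.univ.erase i).erase j,
    B.eval (x p) / (nodeProd x p * ((x p - x i) * (x p - x j))) = S
  generalize ∑ k ∈ Finset.univ.erase i, (x i - x k)⁻¹ = Si
  generalize ∑ k ∈ Finset.univ.erase j, (x j - x k)⁻¹ = Sj
  have := nodeProd_ne_zero hx.1 i
  have := nodeProd_ne_zero hx.1 j
  have := hx.2 i
  have := hx.2 j
  have := hne _ _ hij.symm
  rw [← neg_sub (x j) (x i)]
  field_simp
  ring

/-! ### Curvature of the Benenti metric through slopes of the quotient -/

/-- The difference quotient `(Q(λᵢ) - Q(λⱼ)) / (λᵢ - λⱼ)` of the quotient `Q` of `B` by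
`∏ₖ (X - λₖ)`. -/
def quotientSlope (x : Fin n → ℝ) (i j : Fin n) (B : ℝ[X]) : ℝ :=
  ((B /ₘ Lagrange.nodal Finset.univ x).eval (x i)
    - (B /ₘ Lagrange.nodal Finset.univ x).eval (x j)) / (x i - x j)

/-- The value `0 / 0 = 0` allows sums over all pairs and a curvature formula without the case
distinction `i = j`. -/
theorem quotientSlope_self (x : Fin n → ℝ) (i : Fin n) (B : ℝ[X]) :
    quotientSlope x i i B = 0 := by
  simp [quotientSlope]

theorem riemann_benenti {B : ℝ[X]} {x : Fin n → ℝ} (hx : x ∈ benentiDomain n B)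
    (l k i j : Fin n) :
    riemann (benentiMetric n B) l k i j x = -(1 / 4) * quotientSlope x i j B
      * ((if l = i ∧ k = j then benentiCov B j x else 0)
        - (if l = j ∧ k = i then benentiCov B i x else 0)) := by
  by_cases hij : i = j
  · subst hij
    have h := riemann_antisymm (benentiMetric n B) l k i i x
    rw [quotientSlope_self]
    linarith
  · rw [(isDiagonalMetricOn_benenti n B).riemann_eq hx hx.1 ?_ ?_ ?_ l k i j hij,
      coordCurvature_benenti hx hij, residueSum_eq hx.1 hij, quotientSlope]
    · ring
    · intro i j hij
      rw [benentiLog_of_ne B hij, one_div]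
    · intro l i j hij
      rw [benentiLog_of_ne B hij]
      exact partialDeriv_inv_coord_sub hx.1 l hij.symm
    · intro i l hli
      have d2 := (differentiableAt_eval_coord B.derivative i x).fun_mul
          ((differentiableAt_eval_coord B i x).fun_inv (hx.2 i))
      have d1 : ∀ k ∈ Finset.univ.erase i, DifferentiableAt ℝ (fun y => (y i - y k)⁻¹) x :=
        fun k hk => differentiableAt_inv_coord_sub hx.1 (Finset.ne_of_mem_erase hk).symm
      rw [benentiLog_self, partialDeriv_sub l (DifferentiableAt.fun_sum d1) d2,
        partialDeriv_sum l _ d1,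
        partialDeriv_mul l (differentiableAt_eval_coord B.derivative i x)
          ((differentiableAt_eval_coord B i x).fun_inv (hx.2 i)),
        partialDeriv_inv l (differentiableAt_eval_coord B i x) (hx.2 i),
        partialDeriv_comp_coord l i (B.hasDerivAt (x i)),
        partialDeriv_comp_coord l i (B.derivative.hasDerivAt (x i)), Finset.sum_eq_single l]
      · rw [partialDeriv_inv_coord_sub hx.1 l hli.symm]
        simp only [hli, if_true, if_false]
        ring
      · intro k hk hkl
        rw [partialDeriv_inv_coord_sub hx.1 l (Finset.ne_of_mem_erase hk).symm, if_neg hkl.symm,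
          if_neg hli, sub_zero, zero_div]
      · intro h
        exact absurd (Finset.mem_erase.2 ⟨hli, Finset.mem_univ l⟩) h

theorem scalarCurvature_benenti {B : ℝ[X]} {x : Fin n → ℝ} (hx : x ∈ benentiDomain n B) :
    scalarCurvature (benentiMetric n B) x
      = -(1 / 4) * ∑ k, ∑ i, quotientSlope x i k B := by
  have h := isDiagonalMetricOn_benenti n B
  rw [scalarCurvature, h.eq_diagonal x hx, Finset.mul_sum]
  refine Finset.sum_congr rfl fun k _ => ?_
  rw [Finset.sum_eq_single k (fun j _ hj => by rw [Matrix.diagonal_apply_ne _ hj.symm, zero_mul])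
    (fun hk => absurd (Finset.mem_univ k) hk), Matrix.diagonal_apply_eq, ricci, Finset.mul_sum,
    Finset.mul_sum]
  refine Finset.sum_congr rfl fun i _ => ?_
  have hk := h.ne_zero x hx k
  rw [riemann_benenti hx]
  by_cases hik : i = k
  · subst hik
    rw [quotientSlope_self]
    ring
  · simp only [hik, false_and, and_self, if_true, if_false]
    field_simp
    ring

theorem planeGram_single_benenti {B : ℝ[X]} {x : Fin n → ℝ} (hx : x ∈ benentiDomain n B)
    {i j : Fin n} (hij : i ≠ j) :
    planeGram (benentiMetric n B) x (Pi.single i 1) (Pi.single j 1)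
      = benentiCov B i x * benentiCov B j x := by
  have h := isDiagonalMetricOn_benenti n B
  simp [planeGram, h.inner_eq hx, Pi.single_apply, hij.symm]

theorem sectionalCurvature_single_benenti {B : ℝ[X]} {x : Fin n → ℝ}
    (hx : x ∈ benentiDomain n B) {i j : Fin n} (hij : i ≠ j) :
    sectionalCurvature (benentiMetric n B) x (Pi.single i 1) (Pi.single j 1)
      = -(1 / 4) * quotientSlope x i j B := by
  have h := isDiagonalMetricOn_benenti n B
  have hi := h.ne_zero x hx i
  have hj := h.ne_zero x hx j
  rw [sectionalCurvature, planeGram_single_benenti hx hij, h.inner_eq hx]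
  simp [curvatureOperator, Pi.single_apply, riemann_benenti hx, hij]
  field_simp

/-- Equal slopes turn the curvature tensor into `R(u, v) w = K (g(v, w) u - g(u, w) v)` with `K = -c
/ 4`; here `w = v`. -/
theorem sectionalCurvature_benenti_of_slope_eq {B : ℝ[X]} {x : Fin n → ℝ}
    (hx : x ∈ benentiDomain n B) {c : ℝ} (hc : ∀ i j, i ≠ j → quotientSlope x i j B = c)
    (u v : Fin n → ℝ) (huv : planeGram (benentiMetric n B) x u v ≠ 0) :
    sectionalCurvature (benentiMetric n B) x u v = -(1 / 4) * c := by
  have h := isDiagonalMetricOn_benenti n B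
  have hR : ∀ l k i j, riemann (benentiMetric n B) l k i j x = -(1 / 4) * c
      * ((if l = i then (if k = j then benentiCov B j x else 0) else 0)
        - (if l = j then (if k = i then benentiCov B i x else 0) else 0)) := by
    intro l k i j
    rw [riemann_benenti hx]
    -- For `i = j` the slope is `0`, not `c`, but the bracket vanishes.
    by_cases hij : i = j
    · subst hij
      simp
    · rw [hc i j hij]
      simp only [ite_and]
  have hop : ∀ l, curvatureOperator (benentiMetric n B) x u v v l = -(1 / 4) * c
      * (inner (benentiMetric n B) x v v * u l - inner (benentiMetric n B) x u v * v l) := by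
    intro l
    have e : ∀ k i j : Fin n, riemann (benentiMetric n B) l k i j x * u i * v j * v k
        = (if l = i then (if k = j then -(1 / 4) * c * (benentiCov B j x * v j * v k) * u i
            else 0) else 0)
          - (if l = j then (if k = i then -(1 / 4) * c * (benentiCov B i x * u i * v k) * v j
            else 0) else 0) := by
      intro k i j
      rw [hR]
      split_ifs <;> ring
    have e1 : ∀ k : Fin n, ∑ i, ∑ j, riemann (benentiMetric n B) l k i j x * u i * v j * v k
        = -(1 / 4) * c * (benentiCov B k x * v k * v k) * u l
          - -(1 / 4) * c * (benentiCov B k x * u k * v k) * v l := by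
      intro k
      simp only [e, Finset.sum_sub_distrib]
      congr 1
      · rw [Finset.sum_eq_single l (fun i _ hi => by simp [Ne.symm hi]) (by simp)]
        simp
      · simp
    change ∑ k, ∑ i, ∑ j, riemann (benentiMetric n B) l k i j x * u i * v j * v k = _
    rw [Finset.sum_congr rfl fun k _ => e1 k, Finset.sum_sub_distrib, ← Finset.sum_mul,
      ← Finset.sum_mul, ← Finset.mul_sum, ← Finset.mul_sum, h.inner_eq hx, h.inner_eq hx]
    ring
  have hnum : inner (benentiMetric n B) x (curvatureOperator (benentiMetric n B) x u v v) u
      = -(1 / 4) * c * planeGram (benentiMetric n B) x u v := by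
    have e : ∀ i, benentiCov B i x * (-(1 / 4) * c * (inner (benentiMetric n B) x v v * u i
        - inner (benentiMetric n B) x u v * v i)) * u i
        = -(1 / 4) * c * inner (benentiMetric n B) x v v * (benentiCov B i x * u i * u i)
          - -(1 / 4) * c * inner (benentiMetric n B) x u v * (benentiCov B i x * u i * v i) :=
      fun i => by ring
    rw [h.inner_eq hx]
    simp only [hop, e, Finset.sum_sub_distrib, ← Finset.mul_sum, ← h.inner_eq hx, planeGram]
    ring
  rw [sectionalCurvature, hnum, mul_div_assoc, div_self huv, mul_one]

/-! ### Slopes in low degree and under translation -/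

theorem quotientSlope_eq_zero (x : Fin n → ℝ) (i j : Fin n) {B : ℝ[X]} (hB : B.natDegree ≤ n) :
    quotientSlope x i j B = 0 := by
  have hQ : (B /ₘ Lagrange.nodal Finset.univ x).natDegree = 0 := by
    rw [natDegree_divByMonic B Lagrange.nodal_monic, Lagrange.natDegree_nodal, Finset.card_univ,
      Fintype.card_fin]
    omega
  rw [quotientSlope, eq_C_of_natDegree_eq_zero hQ, eval_C, eval_C, sub_self, zero_div]

theorem quotientSlope_eq_one {x : Fin n → ℝ} (hx : Function.Injective x) {i j : Fin n}
    (hij : i ≠ j) {B : ℝ[X]} (hB : B.Monic) (hd : B.natDegree = n + 1) :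
    quotientSlope x i j B = 1 := by
  have hP : (Lagrange.nodal Finset.univ x).Monic := Lagrange.nodal_monic
  have hPd : (Lagrange.nodal Finset.univ x).natDegree = n := by
    rw [Lagrange.natDegree_nodal, Finset.card_univ, Fintype.card_fin]
  have hQ : (B /ₘ Lagrange.nodal Finset.univ x).natDegree = 1 := by
    rw [natDegree_divByMonic B hP, hPd, hd]
    omega
  have hlc : (B /ₘ Lagrange.nodal Finset.univ x).Monic := by
    rw [Monic, leadingCoeff_divByMonic_of_monic hP, hB]
    rw [degree_eq_natDegree hP.ne_zero, degree_eq_natDegree hB.ne_zero, hPd, hd]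
    exact_mod_cast Nat.le_succ n
  rw [quotientSlope, hlc.eq_X_add_C hQ]
  have := sub_ne_zero.2 (hx.ne hij)
  simp only [eval_add, eval_X, eval_C, add_sub_add_right_eq_sub]
  exact div_self this

/-- The Taylor shift carries the nodal polynomial of the translated nodes to that of `x` and
preserves degrees, so uniqueness of division with remainder identifies the quotients. -/
theorem quotientSlope_add_const (x : Fin n → ℝ) (t : ℝ) (i j : Fin n) (B : ℝ[X]) :
    quotientSlope (fun k => x k + t) i j B = quotientSlope x i j (taylor t B) := by
  have hP : taylor t (Lagrange.nodal Finset.univ fun k => x k + t)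
      = Lagrange.nodal Finset.univ x := by
    rw [taylor_apply, Lagrange.nodal, Lagrange.nodal, prod_comp]
    refine Finset.prod_congr rfl fun k _ => ?_
    rw [sub_comp, X_comp, C_comp, C_add]
    ring
  have h := div_modByMonic_unique (f := taylor t B) (g := Lagrange.nodal Finset.univ x)
    (taylor t (B /ₘ Lagrange.nodal Finset.univ fun k => x k + t))
    (taylor t (B %ₘ Lagrange.nodal Finset.univ fun k => x k + t)) Lagrange.nodal_monic
    ⟨by rw [← hP, ← taylor_mul, ← map_add, modByMonic_add_div], by
      rw [← hP, degree_taylor, degree_taylor]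
      exact degree_modByMonic_lt B Lagrange.nodal_monic⟩
  rw [quotientSlope, quotientSlope, h.1, taylor_eval, taylor_eval, add_sub_add_right_eq_sub]

/-! ### Scalar curvature along the diagonal line -/

/-- The sum of the difference quotients over all pairs of nodes, as a linear function of `B`. -/
def slopeSum (x : Fin n → ℝ) : ℝ[X] →ₗ[ℝ] ℝ :=
  ∑ k, ∑ i ∈ Finset.univ.erase k, -residueSum x i k

/-- Building `slopeSum` from `residueSum` gives linearity in `B` for free; the two expressions agree
at distinct nodes. -/
theorem slopeSum_apply {x : Fin n → ℝ} (hx : Function.Injective x) (B : ℝ[X]) :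
    slopeSum x B = ∑ k, ∑ i, quotientSlope x i k B := by
  simp only [slopeSum, LinearMap.sum_apply, LinearMap.neg_apply]
  refine Finset.sum_congr rfl fun k _ => ?_
  rw [← Finset.add_sum_erase _ _ (Finset.mem_univ k), quotientSlope_self, zero_add]
  refine Finset.sum_congr rfl fun i hi => ?_
  rw [residueSum_eq hx (Finset.ne_of_mem_erase hi), neg_neg, quotientSlope]

theorem slopeSum_X_pow_of_le {x : Fin n → ℝ} (hx : Function.Injective x) {d : ℕ} (hd : d ≤ n) :
    slopeSum x (X ^ d) = 0 := by
  rw [slopeSum_apply hx]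
  exact Finset.sum_eq_zero fun k _ => Finset.sum_eq_zero fun i _ =>
    quotientSlope_eq_zero x i k ((natDegree_X_pow d).trans_le hd)

theorem slopeSum_X_pow_succ {x : Fin n → ℝ} (hx : Function.Injective x) :
    slopeSum x (X ^ (n + 1)) = n * ((n - 1 : ℕ) : ℝ) := by
  rw [slopeSum_apply hx]
  have h : ∀ k : Fin n, ∑ i, quotientSlope x i k (X ^ (n + 1)) = ((n - 1 : ℕ) : ℝ) := by
    intro k
    rw [← Finset.add_sum_erase _ _ (Finset.mem_univ k), quotientSlope_self, zero_add,
      Finset.sum_congr rfl fun i hi => quotientSlope_eq_one hx (Finset.ne_of_mem_erase hi)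
        (monic_X_pow (n + 1)) (natDegree_X_pow (n + 1))]
    simp
  simp [h]

/-- The sum of the difference quotients along the line `λ + t (1, …, 1)`, as a polynomial
in `t`. -/
def slopeSumPoly (x : Fin n → ℝ) (B : ℝ[X]) : ℝ[X] :=
  ∑ d ∈ Finset.range (B.natDegree + 1), C (slopeSum x (X ^ d)) * hasseDeriv d B

/-- The coefficients of `taylor t B` are the Hasse derivatives of `B` at `t`. -/
theorem eval_slopeSumPoly (x : Fin n → ℝ) (B : ℝ[X]) (t : ℝ) :
    (slopeSumPoly x B).eval t = slopeSum x (taylor t B) := by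
  rw [as_sum_range_C_mul_X_pow (taylor t B), natDegree_taylor, map_sum, slopeSumPoly,
    eval_finsetSum]
  refine Finset.sum_congr rfl fun d _ => ?_
  rw [eval_mul, eval_C, ← smul_eq_C_mul, map_smul, taylor_coeff, smul_eq_mul, mul_comm]

/-- Terms with `d ≤ n` have weight zero, and for `d > n + 1` the Hasse derivative has too small a
degree. The term `d = n + 1` gives `n (n - 1)` times the binomial coefficient of `deg B` over `n +
1`, nonzero as `n ≥ 2`. -/
theorem coeff_slopeSumPoly_ne_zero {x : Fin n → ℝ} (hx : Function.Injective x) (hn : 2 ≤ n)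
    {B : ℝ[X]} (hB : B.Monic) (hd : n + 1 ≤ B.natDegree) :
    (slopeSumPoly x B).coeff (B.natDegree - (n + 1)) ≠ 0 := by
  have h1 : B.natDegree - (n + 1) + (n + 1) = B.natDegree := Nat.sub_add_cancel hd
  rw [slopeSumPoly, finsetSum_coeff, Finset.sum_eq_single (n + 1)]
  · rw [coeff_C_mul, hasseDeriv_coeff, slopeSum_X_pow_succ hx, h1, hB.coeff_natDegree, mul_one]
    have h2 : (B.natDegree.choose (n + 1) : ℝ) ≠ 0 := by exact_mod_cast (Nat.choose_pos hd).ne'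
    have h3 : (n : ℝ) ≠ 0 := by exact_mod_cast (by omega : n ≠ 0)
    have h4 : ((n - 1 : ℕ) : ℝ) ≠ 0 := by exact_mod_cast (by omega : n - 1 ≠ 0)
    exact mul_ne_zero (mul_ne_zero h3 h4) h2
  · intro d _ hdn
    rw [coeff_C_mul, hasseDeriv_coeff]
    rcases lt_or_gt_of_ne hdn with h | h
    · rw [slopeSum_X_pow_of_le hx (Nat.lt_succ_iff.1 h), zero_mul]
    · rw [coeff_eq_zero_of_natDegree_lt (by omega), mul_zero, mul_zero]
  · intro h
    exact absurd (Finset.mem_range.2 (by omega)) h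

theorem eq_and_ne_zero_of_scalarCurvature_eq (hn : 2 ≤ n) {B : ℝ[X]} (hB : B.Monic)
    (hd : n + 1 ≤ B.natDegree) {U : Set (Fin n → ℝ)} (hU : IsOpen U) (hne : U.Nonempty)
    (hUD : U ⊆ benentiDomain n B) {c : ℝ}
    (hc : ∀ x ∈ U, scalarCurvature (benentiMetric n B) x = c) :
    B.natDegree = n + 1 ∧ c ≠ 0 := by
  obtain ⟨x, hx⟩ := hne
  have hinj := (hUD hx).1
  have hcont : Continuous fun t : ℝ => fun k => x k + t := by fun_prop
  have hmem : {t : ℝ | (fun k => x k + t) ∈ U} ∈ nhds (0 : ℝ) := by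
    refine (hU.preimage hcont).mem_nhds ?_
    simpa using hx
  have hev : ∀ t ∈ {t : ℝ | (fun k => x k + t) ∈ U},
      (slopeSumPoly x B).eval t = (C (-4 * c)).eval t := by
    intro t ht
    have h1 := hc _ ht
    rw [scalarCurvature_benenti (hUD ht)] at h1
    simp only [quotientSlope_add_const] at h1
    rw [eval_slopeSumPoly, slopeSum_apply hinj, eval_C, ← h1]
    ring
  -- Two polynomials agreeing on a neighbourhood of `0` are equal. A constant has a nonzero
  -- coefficient at index `deg B - (n + 1)` only if that index is `0` and the constant is nonzero.
  have hpoly : slopeSumPoly x B = C (-4 * c) :=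
    eq_of_infinite_eval_eq _ _ ((infinite_of_mem_nhds 0 hmem).mono hev)
  have hcoeff := coeff_slopeSumPoly_ne_zero hinj hn hB hd
  rw [hpoly, coeff_C] at hcoeff
  split_ifs at hcoeff with h0
  · exact ⟨by omega, fun h => hcoeff (by rw [h, mul_zero])⟩
  · exact absurd rfl hcoeff

/-! ### The theorem -/

theorem monic_and_natDegree_of_map_eq_prod {m : ℕ} {B : ℝ[X]} {β : Fin m → ℂ}
    (hB : B.map (algebraMap ℝ ℂ) = ∏ j, (X - C (β j))) : B.Monic ∧ B.natDegree = m := by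
  have hmon : (∏ j, (X - C (β j))).Monic := monic_prod_X_sub_C β Finset.univ
  refine ⟨(monic_map_iff (f := algebraMap ℝ ℂ)).1 (hB ▸ hmon), ?_⟩
  rw [← natDegree_map (algebraMap ℝ ℂ), hB, natDegree_finsetProd_X_sub_C_eq_card]
  simp

end Benenti

end

theorem mainTheorem4 (n m : ℕ) (hn : 2 ≤ n) (B : ℝ[X]) (β : Fin m → ℂ)
    (hβ : Function.Injective β)
    (hB : B.map (algebraMap ℝ ℂ) = ∏ j, (X - C (β j)))
    (U : Set (Fin n → ℝ)) (hU : IsOpen U) (hne : U.Nonempty)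
    (hUD : U ⊆ Benenti.benentiDomain n B) :
    (Benenti.IsFlatOn (Benenti.benentiMetric n B) U ↔ m ≤ n) ∧
    (m = n + 1 →
      ∃ K : ℝ, K ≠ 0 ∧ Benenti.HasConstantCurvatureOn (Benenti.benentiMetric n B) U K) ∧
    (n + 1 < m →
      (¬ ∃ K : ℝ, Benenti.HasConstantCurvatureOn (Benenti.benentiMetric n B) U K) ∧
      ¬ ∃ c : ℝ, ∀ x ∈ U, Benenti.scalarCurvature (Benenti.benentiMetric n B) x = c) := by
  obtain ⟨hmon, rfl⟩ := Benenti.monic_and_natDegree_of_map_eq_prod hB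
  have hscalar : n + 1 < B.natDegree →
      ¬ ∃ c : ℝ, ∀ x ∈ U, Benenti.scalarCurvature (Benenti.benentiMetric n B) x = c := by
    rintro hm ⟨c, hc⟩
    exact hm.ne' (Benenti.eq_and_ne_zero_of_scalarCurvature_eq hn hmon hm.le hU hne hUD hc).1
  refine ⟨⟨fun hflat => ?_, fun hm => ?_⟩, fun hm => ?_, fun hm => ⟨?_, hscalar hm⟩⟩
  · by_contra hm
    -- Flatness makes the scalar curvature the constant `0`, which is excluded once `deg B > n`.
    refine (Benenti.eq_and_ne_zero_of_scalarCurvature_eq (c := 0) hn hmon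
      (Nat.succ_le_of_lt (not_le.1 hm)) hU hne hUD fun x hx => ?_).2 rfl
    simp only [Benenti.scalarCurvature, Benenti.ricci, hflat x hx, Finset.sum_const_zero, mul_zero]
  · intro x hx l k i j
    rw [Benenti.riemann_benenti (hUD hx), Benenti.quotientSlope_eq_zero x i j hm, mul_zero,
      zero_mul]
  · refine ⟨-(1 / 4) * 1, by norm_num, fun x hx u v huv => ?_⟩
    exact Benenti.sectionalCurvature_benenti_of_slope_eq (hUD hx)
      (fun i j hij => Benenti.quotientSlope_eq_one (hUD hx).1 hij hmon hm) u v huv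
  · rintro ⟨K, hK⟩
    -- Constant curvature `K` forces every off-diagonal slope to be `-4 K`, so the scalar curvature
    -- would be constant; the witness equals `n (n - 1) K`.
    refine hscalar hm ⟨-(1 / 4) * ∑ k : Fin n, ∑ i : Fin n, if i = k then 0 else -4 * K,
      fun x hx => ?_⟩
    rw [Benenti.scalarCurvature_benenti (hUD hx)]
    congr 1
    refine Finset.sum_congr rfl fun k _ => Finset.sum_congr rfl fun i _ => ?_
    split_ifs with hik
    · rw [hik, Benenti.quotientSlope_self]
    · have hg := (Benenti.isDiagonalMetricOn_benenti n B).ne_zero x (hUD hx)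
      have h1 := hK x hx (Pi.single i 1) (Pi.single k 1) (by
        rw [Benenti.planeGram_single_benenti (hUD hx) hik]
        exact mul_ne_zero (hg i) (hg k))
      rw [Benenti.sectionalCurvature_single_benenti (hUD hx) hik] at h1
      linarith
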